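/- **Theorem 2 (indecomposability).** Let $M_2$ be the algebra of complex $2\times 2$ matrices, and define linear maps $\Psi_N : M_2^{\otimes N}\to M_2^{\otimes N}$ recursively by $\Psi_0=0$ on $\mathbb C$ and, for $X=\sum_{i,j=1}^2 e_{ij}\otimes X_{ij}\in M_2\otimes M_2^{\otimes N}$, $$\Psi_{N+1}(X)=\frac1{2^N}\begin{pmatrix} (\mathrm{Tr}X-\mathrm{Tr}X_{11})\,\mathbb 1 & -X_{12}-\Psi_N(X_{21})\\ -X_{21}-\Psi_N(X_{12}) & (\mathrm{Tr}X-\mathrm{Tr}X_{22})\,\mathbb 1\end{pmatrix}.$$ Let $P^+=2^{-N}\sum_{i,j=1}^{2^N}e_{ij}\otimes e_{ij}$ and let $$W_N=(I\otimes\Psi_N)P^+=\sum_{i,j}e_{ij}\otimes W_{ij},\qquad W_{ij}=2^{-N}\Psi_N(e_{ij}).$$ Write $X^\Gamma$ for the partial transpose. For $t\in\mathbb R$ let $\rho_t=\sum_{i,j=1}^{2^N}e_{ij}\otimes\rho_{ij}$ be the (unnormalized) matrix with blocks - $\rho_{ii}=2^{-N}\mathbb 1-(2^{N-1}-1)W_{ii}$;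 - $\rho_{ij}=0$ if $i\ne j$ and either $i,j\le 2^{N-1}$ or $i,j>2^{N-1}$; - $\rho_{ij}=-t\,W_{ij}$ if $|i-j|=2^{N-1}$; - $\rho_{ij}=\frac{1}{2^N2^{N-1}}e_{ij}$ in the remaining cases. Then for every $N>1$: 1. The map $\Psi_N$ is indecomposable: it is positive, and it is not of the form $\Phi_1+\Phi_2\circ T$ with $\Phi_1,\Phi_2$ completely positive and $T$ the transposition. 2. Equivalently, $W_N$ is an indecomposable entanglement witness: it is Hermitian, nonnegative on product vectors and has a negative eigenvalue, and it is not of the form $A+B^\Gamma$ with $A,B\ge0$. 3. For $t\in\mathbb R$, $\rho_t$ is a PPT state up to normalization (that is, $0\neq\rho_t\ge0$ and $\rho_t^\Gamma\ge0$) if and only if $|t|\le1$. 4. For all $t\in\mathbb R$, $$\mathrm{Tr}(W_N\rho_t)=\frac{-4t(2^N+4)+2^{N+2}}{2^{4N}}.$$ 5. For $t\in\left(\frac{2^N}{2^N+4},1\right]$ one has $\mathrm{Tr}(W_N\rho_t)<0$, and $\rho_t$ is a PPT entangled state up to normalization (PPT as in 3, and not a finite sum of tensor products of positive semidefinite matrices).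 -/

import Mathlib

open scoped ComplexOrder Kronecker

namespace QubitWitness

/-! ### Maps on matrix algebras and bipartite matrices -/

section General

variable {A B : Type*}

/-- Partial transposition `X ↦ X^Γ` on the second tensor factor. -/
def partialTranspose (X : Matrix (A × B) (A × B) ℂ) : Matrix (A × B) (A × B) ℂ :=
  Matrix.of fun p q => X (p.1, q.2) (q.1, p.2)

/-- The map `I ⊗ Φ`: apply `Φ` to each block `X_{ij}` of `X = ∑ e_{ij} ⊗ X_{ij}`. -/
def idTensor (A : Type*) (Φ : Matrix B B ℂ →ₗ[ℂ] Matrix B B ℂ)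
    (X : Matrix (A × B) (A × B) ℂ) : Matrix (A × B) (A × B) ℂ :=
  Matrix.of fun p q => Φ (Matrix.of fun a b => X (p.1, a) (q.1, b)) p.2 q.2

/-- The projector `P⁺ = (1/d) ∑ e_{ij} ⊗ e_{ij}` onto the maximally entangled vector. -/
noncomputable def maxEntangled (B : Type*) [Fintype B] [DecidableEq B] :
    Matrix (B × B) (B × B) ℂ :=
  Matrix.of fun p q => if p.1 = p.2 ∧ q.1 = q.2 then 1 / (Fintype.card B : ℂ) else 0

/-- A positive map: it sends positive semidefinite matrices to positive semidefinite ones. -/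
def IsPositiveMap (Φ : Matrix B B ℂ →ₗ[ℂ] Matrix B B ℂ) : Prop :=
  ∀ X : Matrix B B ℂ, X.PosSemidef → (Φ X).PosSemidef

/-- A completely positive map: all `I_k ⊗ Φ` preserve positive semidefiniteness. -/
def IsCompletelyPositive (Φ : Matrix B B ℂ →ₗ[ℂ] Matrix B B ℂ) : Prop :=
  ∀ (k : ℕ) (X : Matrix (Fin k × B) (Fin k × B) ℂ),
    X.PosSemidef → (idTensor (Fin k) Φ X).PosSemidef

/-- A decomposable map: `Φ = Φ₁ + Φ₂ ∘ T` with `Φ₁`, `Φ₂` completely positive and `T` the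
transposition. -/
def IsDecomposableMap (Φ : Matrix B B ℂ →ₗ[ℂ] Matrix B B ℂ) : Prop :=
  ∃ Φ₁ Φ₂ : Matrix B B ℂ →ₗ[ℂ] Matrix B B ℂ,
    IsCompletelyPositive Φ₁ ∧ IsCompletelyPositive Φ₂ ∧
      ∀ X : Matrix B B ℂ, Φ X = Φ₁ X + Φ₂ X.transpose

/-- An indecomposable map: a positive map that is not decomposable. -/
def IsIndecomposableMap (Φ : Matrix B B ℂ →ₗ[ℂ] Matrix B B ℂ) : Prop :=
  IsPositiveMap Φ ∧ ¬ IsDecomposableMap Φ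

/-- The product vector `x ⊗ y`. -/
def productVec (x : A → ℂ) (y : B → ℂ) : A × B → ℂ := fun p => x p.1 * y p.2

/-- An entanglement witness: Hermitian, nonnegative on product vectors, and with at least one
negative eigenvalue. -/
def IsEntanglementWitness [Fintype A] [Fintype B] (W : Matrix (A × B) (A × B) ℂ) : Prop :=
  W.IsHermitian ∧
  (∀ (x : A → ℂ) (y : B → ℂ),
    0 ≤ star (productVec x y) ⬝ᵥ W.mulVec (productVec x y)) ∧
  ∃ c : ℝ, c < 0 ∧ ∃ v : A × B → ℂ, v ≠ 0 ∧ W.mulVec v = (c : ℂ) • v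

/-- Decomposability of a bipartite operator: `W = P + Q^Γ` with `P, Q ≥ 0`. -/
def IsDecomposableOperator (W : Matrix (A × B) (A × B) ℂ) : Prop :=
  ∃ P Q : Matrix (A × B) (A × B) ℂ,
    P.PosSemidef ∧ Q.PosSemidef ∧ W = P + partialTranspose Q

/-- An indecomposable entanglement witness. -/
def IsIndecomposableWitness [Fintype A] [Fintype B] (W : Matrix (A × B) (A × B) ℂ) : Prop :=
  IsEntanglementWitness W ∧ ¬ IsDecomposableOperator W

/-- An (unnormalized) state: a nonzero positive semidefinite matrix. -/
def IsUnnormalizedState (ρ : Matrix A A ℂ) : Prop :=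
  ρ.PosSemidef ∧ ρ ≠ 0

/-- An (unnormalized) PPT state. -/
def IsPPTState (ρ : Matrix (A × B) (A × B) ℂ) : Prop :=
  IsUnnormalizedState ρ ∧ (partialTranspose ρ).PosSemidef

/-- Separability of an (unnormalized) state: a finite sum of products of positive semidefinite
matrices. -/
def IsSeparable (ρ : Matrix (A × B) (A × B) ℂ) : Prop :=
  ∃ (r : ℕ) (P : Fin r → Matrix A A ℂ) (Q : Fin r → Matrix B B ℂ),
    (∀ k, (P k).PosSemidef) ∧ (∀ k, (Q k).PosSemidef) ∧ ρ = ∑ k, P k ⊗ₖ Q k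

/-- An (unnormalized) entangled state: a state that is not separable. -/
def IsEntangledState (ρ : Matrix (A × B) (A × B) ℂ) : Prop :=
  IsUnnormalizedState ρ ∧ ¬ IsSeparable ρ

end General

/-! ### The maps `Ψ_N`, the witnesses `W_N` and the states `ρ_t` -/

/-- Labels of the computational basis of `(ℂ²)^{⊗N}`: bit strings of length `N`, the first bit
belonging to the leftmost factor; in the lexicographic enumeration `1, …, 2^N` the strings with
first bit `0` come first, and replacing a first bit `0` by `1` adds `2^(N-1)` to the number. -/
abbrev Bits (N : ℕ) : Type := Fin N → Fin 2

/-- `M₂(ℂ)^{⊗N}`, as matrices indexed by bit strings. -/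
abbrev Mat (N : ℕ) : Type := Matrix (Bits N) (Bits N) ℂ

/-- The block `X_{rs}` of `X = ∑ e_{rs} ⊗ X_{rs}` in `M₂(ℂ) ⊗ M₂(ℂ)^{⊗N}`. -/
def block {N : ℕ} (r s : Fin 2) : Mat (N + 1) →ₗ[ℂ] Mat N where
  toFun X := Matrix.of fun a b => X (Fin.cons r a) (Fin.cons s b)
  map_add' _ _ := rfl
  map_smul' _ _ := rfl

/-- The block `(r, s)` of `Ψ_{N+1}(X)`, up to the factor `1 / 2^N`, in terms of `Ψ = Ψ_N`. -/
def psiBlock {N : ℕ} (Ψ : Mat N →ₗ[ℂ] Mat N) (r s : Fin 2) (X : Mat (N + 1)) : Mat N :=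
  if r = s then (X.trace - (block r r X).trace) • (1 : Mat N)
  else -(block r s X + Ψ (block s r X))

theorem psiBlock_add {N : ℕ} (Ψ : Mat N →ₗ[ℂ] Mat N) (r s : Fin 2) (X Y : Mat (N + 1)) :
    psiBlock Ψ r s (X + Y) = psiBlock Ψ r s X + psiBlock Ψ r s Y := by
  unfold psiBlock
  split_ifs
  · simp only [map_add, Matrix.trace_add, ← add_smul]
    congr 1
    ring
  · simp only [map_add]
    abel

theorem psiBlock_smul {N : ℕ} (Ψ : Mat N →ₗ[ℂ] Mat N) (r s : Fin 2) (c : ℂ) (X : Mat (N + 1)) :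
    psiBlock Ψ r s (c • X) = c • psiBlock Ψ r s X := by
  unfold psiBlock
  split_ifs
  · simp only [map_smul, Matrix.trace_smul, smul_smul, smul_eq_mul, mul_sub]
  · simp only [map_smul, smul_neg, smul_add]

/-- The recursively defined maps `Ψ_N`, with `Ψ_0 = 0`. -/
noncomputable def Psi : (N : ℕ) → Mat N →ₗ[ℂ] Mat N
  | 0 => 0
  | N + 1 =>
    { toFun := fun X => (1 / 2 ^ N : ℂ) • Matrix.of fun i j =>
        psiBlock (Psi N) (i 0) (j 0) X (Fin.tail i) (Fin.tail j)
      map_add' := fun X Y => by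
        ext i j
        simp [psiBlock_add, mul_add]
      map_smul' := fun c X => by
        ext i j
        simp [psiBlock_smul, mul_left_comm] }

/-- The witness `W_N = (I ⊗ Ψ_N) P⁺`. -/
noncomputable def witness (N : ℕ) : Matrix (Bits N × Bits N) (Bits N × Bits N) ℂ :=
  idTensor (Bits N) (Psi N) (maxEntangled (Bits N))

/-- The blocks `W_{ij} = 2^{-N} Ψ_N(e_{ij})`. -/
noncomputable def witnessBlock (N : ℕ) (i j : Bits N) : Mat N :=
  (1 / 2 ^ N : ℂ) • Psi N (Matrix.single i j 1)

/-- The blocks `ρ_{ij}` of `ρ_t` (for `N ≥ 1`; the value at `N = 0` is irrelevant). -/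
noncomputable def rhoBlock : (N : ℕ) → ℝ → Bits N → Bits N → Mat N
  | 0, _, _, _ => 0
  | N + 1, t, i, j =>
    if i = j then
      (1 / 2 ^ (N + 1) : ℂ) • (1 : Mat (N + 1)) - (2 ^ N - 1 : ℂ) • witnessBlock (N + 1) i i
    else if i 0 = j 0 then 0
    else if Fin.tail i = Fin.tail j then -(t : ℂ) • witnessBlock (N + 1) i j
    else (1 / (2 ^ (N + 1) * 2 ^ N) : ℂ) • Matrix.single i j 1

/-- The family `ρ_t = ∑ e_{ij} ⊗ ρ_{ij}`. -/
noncomputable def rho (N : ℕ) (t : ℝ) : Matrix (Bits N × Bits N) (Bits N × Bits N) ℂ :=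
  ∑ i : Bits N, ∑ j : Bits N, Matrix.single i j (1 : ℂ) ⊗ₖ rhoBlock N t i j

end QubitWitness

open QubitWitness

/-!
Positivity of `Ψ_N`. Two facts about `Ψ_N(|b⟩⟨a|)` are proved by induction on `N` from the
recursion: it annihilates `b` and its range is orthogonal to `a` (`psiForm_right_eq_zero`,
`psiForm_left_eq_zero`), and its norm is at most `‖a‖ ‖b‖` (`norm_psiForm_le`). Hence
`|a⟩⟨b| + Ψ_N(|b⟩⟨a|)` also has norm at most `‖a‖ ‖b‖`, the summands acting between orthogonal
pieces. Up to sign this is the off-diagonal block of `2^N Ψ_{N+1}(|x⟩⟨x|)` for `x = (a, b)`, whose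
diagonal blocks are `‖b‖²` and `‖a‖²`; so `Ψ_{N+1}(|x⟩⟨x|)` is positive semidefinite, and by
linearity `Ψ_{N+1}` is positive. Therefore `W_N` is nonnegative on product vectors.

The states. In the computational basis `ρ_t` is, up to a factor, a real symmetric matrix with
explicit elements (`rhoEntry`). For `|t| ≤ 1` it and its partial transpose have dominant diagonals,
so both are positive semidefinite; conversely a `2 × 2` minor of `ρ_t^Γ` is a positive multiple of
`1 - t²`.

The pairing. `Tr (W_N ρ_t)` is summed block by block (`trace_witnessBlock_mul_rhoBlock`); it is
negative for `t = 1`. Since `Tr (W ρ) ≥ 0` whenever `ρ` is PPT and `W` decomposable, or `ρ` is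
separable and `W` nonnegative on product vectors, or both are positive semidefinite, this one
number gives the indecomposability of `W_N` and its negative eigenvalue; for every `t` with
`Tr (W_N ρ_t) < 0` the same pairing shows that `ρ_t` is entangled. Finally a decomposable `Ψ_N`
would have a decomposable Choi matrix `W_N` (`IsDecomposableMap.idTensor_maxEntangled`).
-/

namespace QubitWitness

open Matrix

/-! ### Vectors on bit strings -/

/-- The component `x_r` of `x = e_0 ⊗ x_0 + e_1 ⊗ x_1`. -/
def slice {N : ℕ} (r : Fin 2) (x : Bits (N + 1) → ℂ) : Bits N → ℂ := fun a => x (Fin.cons r a)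

/-- The Euclidean norm of a vector indexed by bit strings. -/
noncomputable def l2 {N : ℕ} (x : Bits N → ℂ) : ℝ := ‖WithLp.toLp 2 x‖

theorem sum_bits_succ {M : Type*} [AddCommMonoid M] {N : ℕ} (f : Bits (N + 1) → M) :
    ∑ i, f i = ∑ r : Fin 2, ∑ a : Bits N, f (Fin.cons r a) := by
  rw [← (Fin.consEquiv fun _ : Fin (N + 1) => Fin 2).sum_comp, Fintype.sum_prod_type]
  rfl

theorem cons_eq_cons_iff {N : ℕ} {r s : Fin 2} {a b : Bits N} :
    (Fin.cons r a : Bits (N + 1)) = Fin.cons s b ↔ r = s ∧ a = b :=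
  Fin.cons_inj

theorem l2_nonneg {N : ℕ} (x : Bits N → ℂ) : 0 ≤ l2 x := norm_nonneg _

theorem l2_eq_zero {N : ℕ} {x : Bits N → ℂ} : l2 x = 0 ↔ x = 0 := by
  simp [l2]

theorem star_dotProduct_self {N : ℕ} (x : Bits N → ℂ) : star x ⬝ᵥ x = ((l2 x ^ 2 : ℝ) : ℂ) := by
  rw [l2, EuclideanSpace.norm_sq_eq, dotProduct]
  push_cast
  exact Finset.sum_congr rfl fun i _ => Complex.conj_mul' _

theorem norm_star_dotProduct_le {N : ℕ} (x y : Bits N → ℂ) : ‖star x ⬝ᵥ y‖ ≤ l2 x * l2 y := by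
  rw [dotProduct_comm, ← EuclideanSpace.inner_toLp_toLp]
  exact norm_inner_le_norm _ _

theorem star_dotProduct_succ {N : ℕ} (x y : Bits (N + 1) → ℂ) :
    star x ⬝ᵥ y = star (slice 0 x) ⬝ᵥ slice 0 y + star (slice 1 x) ⬝ᵥ slice 1 y := by
  simp only [dotProduct, sum_bits_succ, Fin.sum_univ_two]
  rfl

theorem l2_sq_succ {N : ℕ} (x : Bits (N + 1) → ℂ) :
    l2 x ^ 2 = l2 (slice 0 x) ^ 2 + l2 (slice 1 x) ^ 2 := by
  have h := star_dotProduct_succ x x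
  simp only [star_dotProduct_self] at h
  exact_mod_cast h

theorem mul_add_mul_le_of_sq {p q r s U V : ℝ} (hU : 0 ≤ U) (hV : 0 ≤ V)
    (hU2 : U ^ 2 = p ^ 2 + r ^ 2) (hV2 : V ^ 2 = q ^ 2 + s ^ 2) : p * q + r * s ≤ U * V := by
  refine le_of_abs_le (abs_le_of_sq_le_sq ?_ (mul_nonneg hU hV))
  rw [mul_pow, hU2, hV2]
  nlinarith [sq_nonneg (p * s - q * r)]

/-- If `M` vanishes on `b` and its range is orthogonal to `a`, adding `|a⟩⟨b|` to `M` does not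
spoil the bound `‖M‖ ≤ ‖a‖ ‖b‖`: the two summands act between orthogonal pieces. -/
theorem norm_add_rankOne_le {N : ℕ} (M : Mat N) (a b u v : Bits N → ℂ)
    (hM : ∀ u v : Bits N → ℂ, ‖star u ⬝ᵥ M *ᵥ v‖ ≤ l2 u * l2 v * (l2 a * l2 b))
    (hb : M *ᵥ b = 0) (ha : star a ᵥ* M = 0) :
    ‖(star u ⬝ᵥ a) * (star b ⬝ᵥ v) + star u ⬝ᵥ M *ᵥ v‖ ≤ l2 u * l2 v * (l2 a * l2 b) := by
  by_cases h0 : l2 a = 0 ∨ l2 b = 0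
  · have hz : (star u ⬝ᵥ a) * (star b ⬝ᵥ v) = 0 := by
      rcases h0 with h | h <;> rw [l2_eq_zero] at h <;> simp [h]
    rw [hz, zero_add]
    exact hM u v
  push Not at h0
  obtain ⟨ha0, hb0⟩ := h0
  -- splitting of a vector into its component along `c` and the orthogonal rest
  have split : ∀ c w : Bits N → ℂ, l2 c ≠ 0 → ∃ (γ : ℂ) (w' : Bits N → ℂ),
      w = γ • c + w' ∧ star c ⬝ᵥ w = γ * (l2 c ^ 2 : ℝ) ∧
        l2 w ^ 2 = (‖γ‖ * l2 c) ^ 2 + l2 w' ^ 2 := by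
    intro c w hc
    have hc' : ((l2 c ^ 2 : ℝ) : ℂ) ≠ 0 := by exact_mod_cast pow_ne_zero 2 hc
    set γ : ℂ := (star c ⬝ᵥ w) / (l2 c ^ 2 : ℝ) with hγ
    have hcw : star c ⬝ᵥ w = γ * (l2 c ^ 2 : ℝ) := by rw [hγ]; field_simp
    set w' := w - γ • c with hw'
    have hw : w = γ • c + w' := by simp [hw']
    have horth : star c ⬝ᵥ w' = 0 := by
      rw [hw', dotProduct_sub, hcw, dotProduct_smul, star_dotProduct_self, smul_eq_mul, sub_self]
    have horth' : star w' ⬝ᵥ c = 0 := by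
      rw [star_dotProduct, horth, star_zero]
    refine ⟨γ, w', hw, hcw, ?_⟩
    have h := star_dotProduct_self w
    rw [hw] at h
    simp only [star_add, star_smul, add_dotProduct, dotProduct_add, smul_dotProduct,
      dotProduct_smul, horth, horth', star_dotProduct_self, smul_eq_mul, mul_zero, add_zero,
      zero_add] at h
    rw [← hw, ← mul_assoc, Complex.star_def, Complex.mul_conj'] at h
    rw [mul_pow]
    exact_mod_cast h.symm
  obtain ⟨α, u', hu, hau, hun⟩ := split a u ha0
  obtain ⟨β, v', hv, hbv, hvn⟩ := split b v hb0
  have h1 : star u ⬝ᵥ M *ᵥ v = star u' ⬝ᵥ M *ᵥ v' := by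
    rw [hu, hv, mulVec_add, mulVec_smul, hb, smul_zero, zero_add, star_add, add_dotProduct,
      star_smul, smul_dotProduct, dotProduct_mulVec (star a), ha, zero_dotProduct, smul_zero,
      zero_add]
  have h2 : ‖star u ⬝ᵥ a‖ = ‖α‖ * l2 a ^ 2 := by
    rw [star_dotProduct, norm_star, hau, norm_mul,
      Complex.norm_real, Real.norm_of_nonneg (sq_nonneg _)]
  have h3 : ‖star b ⬝ᵥ v‖ = ‖β‖ * l2 b ^ 2 := by
    rw [hbv, norm_mul, Complex.norm_real, Real.norm_of_nonneg (sq_nonneg _)]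
  calc ‖(star u ⬝ᵥ a) * (star b ⬝ᵥ v) + star u ⬝ᵥ M *ᵥ v‖
      ≤ ‖star u ⬝ᵥ a‖ * ‖star b ⬝ᵥ v‖ + l2 u' * l2 v' * (l2 a * l2 b) := by
        rw [h1, ← norm_mul]
        exact (norm_add_le _ _).trans (by gcongr; exact hM u' v')
    _ = (‖α‖ * l2 a * (‖β‖ * l2 b) + l2 u' * l2 v') * (l2 a * l2 b) := by rw [h2, h3]; ring
    _ ≤ l2 u * l2 v * (l2 a * l2 b) := by
        have := l2_nonneg a
        have := l2_nonneg b
        gcongr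
        exact mul_add_mul_le_of_sq (l2_nonneg _) (l2_nonneg _) hun hvn

/-! ### Sesquilinear forms of `Ψ_N` -/

theorem dotProduct_Psi_succ {N : ℕ} (X : Mat (N + 1)) (u v : Bits (N + 1) → ℂ) :
    star u ⬝ᵥ Psi (N + 1) X *ᵥ v = (1 / 2 ^ N : ℂ) * ∑ r : Fin 2, ∑ s : Fin 2,
      star (slice r u) ⬝ᵥ psiBlock (Psi N) r s X *ᵥ slice s v := by
  have h : ∀ i j, Psi (N + 1) X i j =
      (1 / 2 ^ N : ℂ) * psiBlock (Psi N) (i 0) (j 0) X (Fin.tail i) (Fin.tail j) := fun _ _ => rfl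
  simp only [dotProduct, mulVec, sum_bits_succ, h, Finset.mul_sum, Fin.cons_zero, Fin.tail_cons,
    Pi.star_apply, slice]
  refine Finset.sum_congr rfl fun r _ => ?_
  rw [Finset.sum_comm]
  refine Finset.sum_congr rfl fun s _ => Finset.sum_congr rfl fun a _ =>
    Finset.sum_congr rfl fun b _ => ?_
  ring

/-- The form `⟨u, Ψ_N(|b⟩⟨a|) v⟩`. -/
noncomputable def psiForm (N : ℕ) (u b a v : Bits N → ℂ) : ℂ :=
  star u ⬝ᵥ Psi N (vecMulVec b (star a)) *ᵥ v

theorem psiForm_zero (u b a v : Bits 0 → ℂ) : psiForm 0 u b a v = 0 := by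
  simp [psiForm, Psi]

theorem block_vecMulVec {N : ℕ} (r s : Fin 2) (b a : Bits (N + 1) → ℂ) :
    block r s (vecMulVec b (star a)) = vecMulVec (slice r b) (star (slice s a)) := rfl

theorem psiForm_succ (N : ℕ) (u b a v : Bits (N + 1) → ℂ) :
    psiForm (N + 1) u b a v = (1 / 2 ^ N : ℂ) *
      ((star (slice 1 a) ⬝ᵥ slice 1 b) * (star (slice 0 u) ⬝ᵥ slice 0 v)
      + (star (slice 0 a) ⬝ᵥ slice 0 b) * (star (slice 1 u) ⬝ᵥ slice 1 v)
      - ((star (slice 0 u) ⬝ᵥ slice 0 b) * (star (slice 1 a) ⬝ᵥ slice 1 v)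
        + psiForm N (slice 0 u) (slice 1 b) (slice 0 a) (slice 1 v))
      - ((star (slice 1 u) ⬝ᵥ slice 1 b) * (star (slice 0 a) ⬝ᵥ slice 0 v)
        + psiForm N (slice 1 u) (slice 0 b) (slice 1 a) (slice 0 v))) := by
  have key : ∀ x y z w : Bits N → ℂ,
      star x ⬝ᵥ vecMulVec y (star z) *ᵥ w = (star x ⬝ᵥ y) * (star z ⬝ᵥ w) := by
    intro x y z w
    rw [vecMulVec_mulVec, dotProduct_smul]
    simp
  rw [psiForm, dotProduct_Psi_succ]
  simp only [Fin.sum_univ_two, psiBlock, block_vecMulVec, if_true,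
    show (0 : Fin 2) ≠ 1 from by decide, show (1 : Fin 2) ≠ 0 from by decide, if_false, neg_mulVec,
    add_mulVec, smul_mulVec, one_mulVec, dotProduct_neg, dotProduct_add, dotProduct_smul, key,
    trace_vecMulVec, smul_eq_mul, psiForm]
  rw [dotProduct_comm b, star_dotProduct_succ a b, dotProduct_comm (slice 0 b),
    dotProduct_comm (slice 1 b)]
  ring

/-- `Ψ_N(|b⟩⟨a|)` annihilates `b`. -/
theorem psiForm_right_eq_zero (N : ℕ) (u b a : Bits N → ℂ) : psiForm N u b a b = 0 := by
  induction N with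
  | zero => exact psiForm_zero _ _ _ _
  | succ N ih =>
    rw [psiForm_succ, ih, ih]
    ring

/-- The range of `Ψ_N(|b⟩⟨a|)` is orthogonal to `a`. -/
theorem psiForm_left_eq_zero (N : ℕ) (b a v : Bits N → ℂ) : psiForm N a b a v = 0 := by
  induction N with
  | zero => exact psiForm_zero _ _ _ _
  | succ N ih =>
    rw [psiForm_succ, ih, ih]
    ring

theorem star_psiForm (N : ℕ) (u b a v : Bits N → ℂ) :
    star (psiForm N u b a v) = psiForm N v a b u := by
  have key : ∀ {N : ℕ} (x y : Bits N → ℂ), star (star x ⬝ᵥ y) = star y ⬝ᵥ x := fun x y =>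
    (star_dotProduct y x).symm
  induction N with
  | zero => simp [psiForm_zero]
  | succ N ih =>
    rw [psiForm_succ, psiForm_succ]
    simp only [star_mul', star_add, star_sub, key, ih, star_div₀, star_one, star_pow, star_ofNat]
    ring

/-- `Ψ_N` maps `|b⟩⟨a|` to an operator of norm at most `‖a‖ ‖b‖`. -/
theorem norm_psiForm_le (N : ℕ) (u b a v : Bits N → ℂ) :
    ‖psiForm N u b a v‖ ≤ l2 u * l2 v * (l2 a * l2 b) := by
  induction N with
  | zero =>
    rw [psiForm_zero, norm_zero]
    have := l2_nonneg u
    have := l2_nonneg v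
    have := l2_nonneg a
    have := l2_nonneg b
    positivity
  | succ N ih =>
    have n0 := fun x : Bits (N + 1) → ℂ => l2_nonneg (slice 0 x)
    have n1 := fun x : Bits (N + 1) → ℂ => l2_nonneg (slice 1 x)
    have nn := fun x : Bits (N + 1) → ℂ => l2_nonneg x
    have hd : ∀ {M : ℕ} (x y z w : Bits M → ℂ),
        ‖(star x ⬝ᵥ y) * (star z ⬝ᵥ w)‖ ≤ (l2 x * l2 y) * (l2 z * l2 w) := fun x y z w => by
      rw [norm_mul]
      exact mul_le_mul (norm_star_dotProduct_le _ _) (norm_star_dotProduct_le _ _)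
        (norm_nonneg _) (mul_nonneg (l2_nonneg _) (l2_nonneg _))
    have cs : ∀ x y : Bits (N + 1) → ℂ,
        l2 (slice 0 x) * l2 (slice 0 y) + l2 (slice 1 x) * l2 (slice 1 y) ≤ l2 x * l2 y :=
      fun x y => mul_add_mul_le_of_sq (nn x) (nn y) (l2_sq_succ x) (l2_sq_succ y)
    have cs' : ∀ x y : Bits (N + 1) → ℂ,
        l2 (slice 0 x) * l2 (slice 1 y) + l2 (slice 1 x) * l2 (slice 0 y) ≤ l2 x * l2 y :=
      fun x y => mul_add_mul_le_of_sq (nn x) (nn y) (l2_sq_succ x)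
        ((l2_sq_succ y).trans (add_comm _ _))
    have d1 := hd (slice 1 a) (slice 1 b) (slice 0 u) (slice 0 v)
    have d2 := hd (slice 0 a) (slice 0 b) (slice 1 u) (slice 1 v)
    have d3 := hd (slice 0 u) (slice 0 b) (slice 1 a) (slice 1 v)
    have d4 := hd (slice 1 u) (slice 1 b) (slice 0 a) (slice 0 v)
    rw [psiForm_succ]
    rcases Nat.eq_zero_or_pos N with rfl | hN
    · -- for `Ψ_1` the prefactor is `1`, so the general estimate, which loses a factor `2`, is not
      -- enough; but `Ψ_0 = 0`, and the four terms left are bounded by a product of two sums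
      simp only [psiForm_zero, add_zero, pow_zero, div_one, one_mul]
      have h1 := cs' a u
      have h2 := cs' b v
      have h3 := mul_le_mul h1 h2 (add_nonneg (mul_nonneg (n0 b) (n1 v))
        (mul_nonneg (n1 b) (n0 v))) (mul_nonneg (nn a) (nn u))
      refine (norm_sub_le _ _).trans ((add_le_add ((norm_sub_le _ _).trans
        (add_le_add (norm_add_le _ _) le_rfl)) le_rfl).trans ?_)
      linarith
    · have e1 := ih (slice 0 u) (slice 1 b) (slice 0 a) (slice 1 v)
      have e2 := ih (slice 1 u) (slice 0 b) (slice 1 a) (slice 0 v)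
      have h1 := mul_le_mul (cs a b) (cs u v) (add_nonneg (mul_nonneg (n0 u) (n0 v))
        (mul_nonneg (n1 u) (n1 v))) (mul_nonneg (nn a) (nn b))
      have h2 := mul_le_mul (cs' a b) (cs' u v) (add_nonneg (mul_nonneg (n0 u) (n1 v))
        (mul_nonneg (n1 u) (n0 v))) (mul_nonneg (nn a) (nn b))
      have p1 := mul_nonneg (mul_nonneg (n0 a) (n0 b)) (mul_nonneg (n0 u) (n0 v))
      have p2 := mul_nonneg (mul_nonneg (n1 a) (n1 b)) (mul_nonneg (n1 u) (n1 v))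
      have hsum : ∀ z₁ z₂ z₃ z₄ z₅ z₆ : ℂ, ‖z₁ + z₂ - (z₃ + z₄) - (z₅ + z₆)‖ ≤
          ‖z₁‖ + ‖z₂‖ + (‖z₃‖ + ‖z₄‖) + (‖z₅‖ + ‖z₆‖) := fun z₁ z₂ z₃ z₄ z₅ z₆ =>
        (norm_sub_le _ _).trans (add_le_add ((norm_sub_le _ _).trans
          (add_le_add (norm_add_le _ _) (norm_add_le _ _))) (norm_add_le _ _))
      have hpow : (2 : ℝ) ≤ 2 ^ N := by
        calc (2 : ℝ) = 2 ^ 1 := by norm_num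
          _ ≤ 2 ^ N := pow_le_pow_right₀ (by norm_num) hN
      -- the diagonal and the off-diagonal blocks contribute at most one unit each, and `2 ≤ 2 ^ N`
      rw [norm_mul, norm_div, norm_one, norm_pow, Complex.norm_ofNat, one_div,
        inv_mul_le_iff₀ (by positivity)]
      have hT : 2 * (l2 u * l2 v * (l2 a * l2 b)) ≤ 2 ^ N * (l2 u * l2 v * (l2 a * l2 b)) :=
        mul_le_mul_of_nonneg_right hpow
          (mul_nonneg (mul_nonneg (nn u) (nn v)) (mul_nonneg (nn a) (nn b)))
      refine (hsum _ _ _ _ _ _).trans (le_trans ?_ hT)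
      linarith

/-- For unit vectors `a` and `b`, `|a⟩⟨b| + Ψ_N(|b⟩⟨a|)` is a contraction. For `x = (x_0, x_1)`
this operator with `a = x_0`, `b = x_1` is, up to sign and scale, the off-diagonal block of
`Ψ_{N+1}(|x⟩⟨x|)`. -/
theorem norm_rankOne_add_psiForm_le (N : ℕ) (u b a v : Bits N → ℂ) :
    ‖(star u ⬝ᵥ a) * (star b ⬝ᵥ v) + psiForm N u b a v‖ ≤ l2 u * l2 v * (l2 a * l2 b) := by
  refine norm_add_rankOne_le (Psi N (vecMulVec b (star a))) a b u v
    (fun u v => norm_psiForm_le N u b a v) ?_ ?_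
  · ext i
    have := psiForm_right_eq_zero N (Pi.single i 1) b a
    rw [psiForm, ← Pi.single_star, star_one, single_one_dotProduct] at this
    exact this
  · ext i
    have := psiForm_left_eq_zero N b a (Pi.single i 1)
    rw [psiForm, dotProduct_mulVec, dotProduct_single_one] at this
    exact this

/-- The two off-diagonal blocks of `2^N Ψ_{N+1}(|x⟩⟨x|)` are adjoint to each other and of norm at most
`‖x_0‖ ‖x_1‖`, while the diagonal ones are `‖x_1‖²` and `‖x_0‖²`. -/
theorem psiForm_nonneg (N : ℕ) (u x : Bits N → ℂ) : 0 ≤ psiForm N u x x u := by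
  cases N with
  | zero => rw [psiForm_zero]
  | succ N =>
    have hK := norm_rankOne_add_psiForm_le N (slice 0 u) (slice 1 x) (slice 0 x) (slice 1 u)
    set K := (star (slice 0 u) ⬝ᵥ slice 0 x) * (star (slice 1 x) ⬝ᵥ slice 1 u)
      + psiForm N (slice 0 u) (slice 1 x) (slice 0 x) (slice 1 u) with hKdef
    have key : ∀ x y : Bits N → ℂ, star (star x ⬝ᵥ y) = star y ⬝ᵥ x := fun x y =>
      (star_dotProduct y x).symm
    have hK' : (star (slice 1 u) ⬝ᵥ slice 1 x) * (star (slice 0 x) ⬝ᵥ slice 0 u)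
        + psiForm N (slice 1 u) (slice 0 x) (slice 1 x) (slice 0 u) = star K := by
      rw [hKdef, star_add, star_mul', key, key, star_psiForm, mul_comm]
    rw [psiForm_succ, ← hKdef, hK']
    simp only [star_dotProduct_self]
    have hre : K.re ≤ l2 (slice 0 u) * l2 (slice 1 u) * (l2 (slice 0 x) * l2 (slice 1 x)) :=
      (Complex.re_le_norm K).trans hK
    have h2 : star K = ((2 * K.re : ℝ) : ℂ) - K := by
      rw [eq_sub_iff_add_eq, add_comm, Complex.star_def, Complex.add_conj]
    have h3 : (0 : ℝ) ≤ 1 / 2 ^ N * (l2 (slice 1 x) ^ 2 * l2 (slice 0 u) ^ 2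
        + l2 (slice 0 x) ^ 2 * l2 (slice 1 u) ^ 2 - 2 * K.re) := by
      refine mul_nonneg (by positivity) ?_
      nlinarith [sq_nonneg (l2 (slice 1 x) * l2 (slice 0 u) - l2 (slice 0 x) * l2 (slice 1 u))]
    convert Complex.zero_le_real.2 h3 using 1
    rw [h2]
    push_cast
    ring

theorem Psi_vecMulVec_posSemidef (N : ℕ) (x : Bits N → ℂ) :
    (Psi N (vecMulVec x (star x))).PosSemidef := by
  refine .of_dotProduct_mulVec_nonneg ?_ fun u => psiForm_nonneg N u x
  ext i j
  have h := star_psiForm N (Pi.single j 1) x x (Pi.single i 1)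
  simpa [psiForm, ← Pi.single_star] using h

theorem Psi_isPositiveMap (N : ℕ) : IsPositiveMap (Psi N) := by
  intro X hX
  obtain ⟨m, v, rfl⟩ := posSemidef_iff_eq_sum_vecMulVec.1 hX
  rw [map_sum]
  exact posSemidef_sum _ fun i _ => Psi_vecMulVec_posSemidef N (v i)

/-! ### Duality between witnesses and states -/

section Duality

variable {A B : Type*} [Fintype A] [Fintype B]

theorem trace_mul_vecMulVec_star (M : Matrix A A ℂ) (x : A → ℂ) :
    (M * vecMulVec x (star x)).trace = star x ⬝ᵥ M *ᵥ x := by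
  rw [mul_vecMulVec, trace_vecMulVec, dotProduct_comm]

theorem trace_mul_nonneg_of_posSemidef {P Q : Matrix A A ℂ} (hP : P.PosSemidef)
    (hQ : Q.PosSemidef) : 0 ≤ (P * Q).trace := by
  obtain ⟨m, v, rfl⟩ := posSemidef_iff_eq_sum_vecMulVec.1 hQ
  rw [Finset.mul_sum, trace_sum]
  exact Finset.sum_nonneg fun i _ => by
    rw [trace_mul_vecMulVec_star]
    exact hP.dotProduct_mulVec_nonneg _

/-- Partial transposition is self-adjoint for the trace pairing. -/
theorem trace_partialTranspose_mul (X Y : Matrix (A × B) (A × B) ℂ) :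
    (partialTranspose X * Y).trace = (X * partialTranspose Y).trace := by
  simp only [trace, diag_apply, mul_apply, partialTranspose, of_apply, Fintype.sum_prod_type]
  refine Finset.sum_congr rfl fun i _ => ?_
  rw [Finset.sum_comm]
  conv_rhs => rw [Finset.sum_comm]
  exact Finset.sum_congr rfl fun j _ => Finset.sum_comm

theorem not_isDecomposableOperator_of_trace_neg {W ρ : Matrix (A × B) (A × B) ℂ}
    (hρ : IsPPTState ρ) (h : (W * ρ).trace < 0) : ¬ IsDecomposableOperator W := by
  rintro ⟨P, Q, hP, hQ, rfl⟩
  refine h.not_ge ?_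
  rw [add_mul, trace_add, trace_partialTranspose_mul]
  exact add_nonneg (trace_mul_nonneg_of_posSemidef hP hρ.1.1)
    (trace_mul_nonneg_of_posSemidef hQ hρ.2)

theorem not_isSeparable_of_trace_neg {W ρ : Matrix (A × B) (A × B) ℂ}
    (hW : ∀ (x : A → ℂ) (y : B → ℂ), 0 ≤ star (productVec x y) ⬝ᵥ W.mulVec (productVec x y))
    (h : (W * ρ).trace < 0) : ¬ IsSeparable ρ := by
  rintro ⟨r, P, Q, hP, hQ, rfl⟩
  refine h.not_ge ?_
  rw [Finset.mul_sum, trace_sum]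
  refine Finset.sum_nonneg fun k _ => ?_
  obtain ⟨m, x, hx⟩ := posSemidef_iff_eq_sum_vecMulVec.1 (hP k)
  obtain ⟨n, y, hy⟩ := posSemidef_iff_eq_sum_vecMulVec.1 (hQ k)
  have hk : P k ⊗ₖ Q k = ∑ i, ∑ j, vecMulVec (productVec (x i) (y j))
      (star (productVec (x i) (y j))) := by
    ext p q
    simp only [hx, hy, kroneckerMap_apply, Matrix.sum_apply, Finset.sum_mul_sum, vecMulVec_apply,
      productVec, Pi.star_apply, star_mul']
    exact Finset.sum_congr rfl fun i _ => Finset.sum_congr rfl fun j _ => by ring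
  rw [hk]
  simp only [Finset.mul_sum, trace_sum, trace_mul_vecMulVec_star]
  exact Finset.sum_nonneg fun i _ => Finset.sum_nonneg fun j _ => hW _ _

theorem exists_neg_eigenvalue_of_trace_neg {W ρ : Matrix A A ℂ} (hW : W.IsHermitian)
    (hρ : ρ.PosSemidef) (h : (W * ρ).trace < 0) :
    ∃ c : ℝ, c < 0 ∧ ∃ v : A → ℂ, v ≠ 0 ∧ W.mulVec v = (c : ℂ) • v := by
  classical
  by_contra hc
  refine h.not_ge (trace_mul_nonneg_of_posSemidef ?_ hρ)
  rw [hW.posSemidef_iff_eigenvalues_nonneg]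
  intro i
  by_contra hi
  refine hc ⟨hW.eigenvalues i, not_le.1 hi, WithLp.ofLp (hW.eigenvectorBasis i), ?_, ?_⟩
  · intro h0
    exact hW.eigenvectorBasis.orthonormal.ne_zero i (by ext k; exact congrFun h0 k)
  · rw [hW.mulVec_eigenvectorBasis]
    rfl

/-- A real symmetric matrix with dominant diagonal is positive semidefinite, by Gershgorin's
theorem. The sum includes the diagonal element, whence the factor `2`. -/
theorem posSemidef_of_sum_abs_le {R : Matrix A A ℝ} (hR : ∀ p q, R p q = R q p)
    (h : ∀ p, ∑ q, |R p q| ≤ 2 * R p p) :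
    (of fun p q => (R p q : ℂ) : Matrix A A ℂ).PosSemidef := by
  classical
  set M : Matrix A A ℂ := of fun p q => (R p q : ℂ) with hM
  have hH : M.IsHermitian := by
    ext p q
    simp [hM, hR q p]
  rw [hH.posSemidef_iff_eigenvalues_nonneg]
  intro i
  have hev : Module.End.HasEigenvalue (toLin' M) ((hH.eigenvalues i : ℝ) : ℂ) := by
    refine Module.End.hasEigenvalue_of_hasEigenvector
      (x := WithLp.ofLp (hH.eigenvectorBasis i)) ⟨?_, ?_⟩
    · rw [Module.End.mem_eigenspace_iff, toLin'_apply, hH.mulVec_eigenvectorBasis]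
      rfl
    · intro h0
      exact hH.eigenvectorBasis.orthonormal.ne_zero i (by ext k; exact congrFun h0 k)
  obtain ⟨k, hk⟩ := eigenvalue_mem_ball hev
  rw [mem_closedBall_iff_norm] at hk
  simp only [show ∀ p q, M p q = (R p q : ℂ) from fun _ _ => rfl,
    ← Complex.ofReal_sub, Complex.norm_real, Real.norm_eq_abs] at hk
  have h1 := h k
  rw [← Finset.add_sum_erase _ _ (Finset.mem_univ k)] at h1
  have h2 := (abs_le.1 hk).1
  have h3 := le_abs_self (R k k)
  simp only [Pi.zero_apply]
  linarith

end Duality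

/-! ### The matrix `(I ⊗ Φ) P⁺` -/

section Choi

variable {B : Type*} [Fintype B] [DecidableEq B]

theorem idTensor_maxEntangled_apply (Φ : Matrix B B ℂ →ₗ[ℂ] Matrix B B ℂ) (p q : B × B) :
    idTensor B Φ (maxEntangled B) p q =
      (1 / (Fintype.card B : ℂ)) * Φ (single p.1 q.1 1) p.2 q.2 := by
  have h : (of fun a b => maxEntangled B (p.1, a) (q.1, b)) =
      (1 / (Fintype.card B : ℂ)) • single p.1 q.1 1 := by
    ext a b
    simp [maxEntangled, single_apply]
  rw [idTensor, of_apply, h, map_smul]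
  rfl

/-- The expectation of `(I ⊗ Φ) P⁺` in `x ⊗ y` is `⟨y, Φ(|x̄⟩⟨x̄|) y⟩ / d`. -/
theorem productVec_idTensor_maxEntangled_nonneg {Φ : Matrix B B ℂ →ₗ[ℂ] Matrix B B ℂ}
    (hΦ : IsPositiveMap Φ) (x y : B → ℂ) :
    0 ≤ star (productVec x y) ⬝ᵥ (idTensor B Φ (maxEntangled B)).mulVec (productVec x y) := by
  have hx : vecMulVec (star x) x = ∑ i, ∑ j, (star (x i) * x j) • single i j (1 : ℂ) := by
    rw [matrix_eq_sum_single (vecMulVec (star x) x)]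
    simp [vecMulVec_apply, smul_single]
  have h := (hΦ _ (posSemidef_vecMulVec_star_self x)).dotProduct_mulVec_nonneg y
  have hc : (0 : ℂ) ≤ 1 / (Fintype.card B : ℂ) := by positivity
  refine (mul_nonneg hc h).trans_eq ?_
  rw [hx]
  simp only [map_sum, map_smul, dotProduct, mulVec, Fintype.sum_prod_type, Matrix.sum_apply,
    Matrix.smul_apply, idTensor_maxEntangled_apply, productVec, Pi.star_apply, star_mul', Finset.mul_sum,
    Finset.sum_mul, smul_eq_mul]
  -- the sums on the left run over `k, l, i, j`, those on the right over `i, k, j, l`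
  rw [Finset.sum_congr rfl fun k _ => Finset.sum_comm, Finset.sum_comm]
  refine Finset.sum_congr rfl fun i _ => Finset.sum_congr rfl fun k _ => ?_
  rw [Finset.sum_comm]
  refine Finset.sum_congr rfl fun j _ => Finset.sum_congr rfl fun l _ => ?_
  ring

theorem maxEntangled_posSemidef : (maxEntangled B).PosSemidef := by
  have h : maxEntangled B = (1 / (Fintype.card B : ℂ)) •
      vecMulVec (fun p : B × B => if p.1 = p.2 then 1 else 0)
        (star fun p : B × B => if p.1 = p.2 then (1 : ℂ) else 0) := by
    ext p q
    by_cases hp : p.1 = p.2 <;> by_cases hq : q.1 = q.2 <;>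
      simp [maxEntangled, vecMulVec_apply, hp, hq]
  rw [h]
  exact (posSemidef_vecMulVec_self_star _).smul (by positivity)

theorem idTensor_maxEntangled_posSemidef {Φ : Matrix B B ℂ →ₗ[ℂ] Matrix B B ℂ}
    (hΦ : IsCompletelyPositive Φ) : (idTensor B Φ (maxEntangled B)).PosSemidef := by
  set e : B ≃ Fin (Fintype.card B) := Fintype.equivFin B
  have h := hΦ _ _ ((maxEntangled_posSemidef (B := B)).submatrix (Prod.map e.symm id))
  have h2 := h.submatrix (Prod.map e id)
  convert h2 using 1
  ext p q
  simp [idTensor]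

/-- If `Φ` is decomposable, so is its Choi matrix. -/
theorem IsDecomposableMap.idTensor_maxEntangled {Φ : Matrix B B ℂ →ₗ[ℂ] Matrix B B ℂ}
    (hΦ : IsDecomposableMap Φ) :
    IsDecomposableOperator (idTensor B Φ (maxEntangled B)) := by
  obtain ⟨Φ₁, Φ₂, h₁, h₂, h⟩ := hΦ
  -- `Φ₂ ∘ T` transposes the first factor, that is, the second one after a full transposition
  refine ⟨_, _, idTensor_maxEntangled_posSemidef h₁,
    (idTensor_maxEntangled_posSemidef h₂).transpose, ?_⟩
  ext p q
  simp only [Matrix.add_apply, partialTranspose, of_apply, transpose_apply, idTensor_maxEntangled_apply,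
    h, transpose_single, mul_add]

end Choi

theorem witness_apply (N : ℕ) (p q : Bits N × Bits N) :
    witness N p q = witnessBlock N p.1 q.1 p.2 q.2 := by
  rw [witness, idTensor_maxEntangled_apply, witnessBlock, Matrix.smul_apply, smul_eq_mul]
  simp

theorem witness_isHermitian (N : ℕ) : (witness N).IsHermitian := by
  have hs : ∀ i j : Bits N,
      single i j (1 : ℂ) = vecMulVec (Pi.single i 1) (star (Pi.single j 1)) := by
    intro i j
    rw [← Pi.single_star, star_one, single_eq_single_vecMulVec_single]
  ext p q
  have h := star_psiForm N (Pi.single q.2 1) (Pi.single q.1 1) (Pi.single p.1 1)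
    (Pi.single p.2 1)
  simp only [psiForm, ← hs] at h
  simp only [← Pi.single_star, star_one, single_one_dotProduct, mulVec_single_one, col_apply] at h
  rw [conjTranspose_apply, witness_apply, witness_apply, witnessBlock, witnessBlock, Matrix.smul_apply,
    Matrix.smul_apply, smul_eq_mul, smul_eq_mul, star_mul', h]
  simp

/-! ### Matrix elements of `W_N` and `ρ_t` -/

/-- The bit string with the first bit of `i` toggled. -/
def flipFirst {N : ℕ} (i : Bits (N + 1)) : Bits (N + 1) := Fin.cons (i 0 + 1) (Fin.tail i)

theorem ne_iff_eq_add_one {r s : Fin 2} : r ≠ s ↔ s = r + 1 := by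
  revert r s
  decide

theorem eq_of_ne_of_ne {r s t : Fin 2} : r ≠ s → r ≠ t → s = t := by
  revert r s t
  decide

theorem eq_iff_tail {N : ℕ} {i j : Bits (N + 1)} : i = j ↔ i 0 = j 0 ∧ Fin.tail i = Fin.tail j := by
  rw [← Fin.cons_self_tail i, ← Fin.cons_self_tail j, cons_eq_cons_iff]
  simp

theorem eq_flipFirst_iff {N : ℕ} {i j : Bits (N + 1)} :
    j = flipFirst i ↔ i 0 ≠ j 0 ∧ Fin.tail i = Fin.tail j := by
  rw [eq_iff_tail, ne_iff_eq_add_one, flipFirst, Fin.cons_zero, Fin.tail_cons,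
    eq_comm (a := Fin.tail i)]

theorem flipFirst_zero {N : ℕ} (i : Bits (N + 1)) : flipFirst i 0 ≠ i 0 :=
  (eq_flipFirst_iff.1 (rfl : flipFirst i = flipFirst i)).1.symm

theorem tail_flipFirst {N : ℕ} (i : Bits (N + 1)) : Fin.tail (flipFirst i) = Fin.tail i :=
  (eq_flipFirst_iff.1 (rfl : flipFirst i = flipFirst i)).2.symm

theorem sum_first_ne {N : ℕ} (r : Fin 2) (c : ℝ) :
    ∑ k : Bits (N + 1), (if k 0 ≠ r then c else 0) = 2 ^ N * c := by
  rw [sum_bits_succ]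
  simp only [Fin.cons_zero, Finset.sum_const, Finset.card_univ, Fintype.card_fun, Fintype.card_fin,
    nsmul_eq_mul, Fin.sum_univ_two]
  fin_cases r <;> simp

theorem block_single {N : ℕ} (r s : Fin 2) (i j : Bits (N + 1)) :
    block r s (single i j 1) =
      if i 0 = r ∧ j 0 = s then single (Fin.tail i) (Fin.tail j) 1 else 0 := by
  ext a b
  have h : block r s (single i j (1 : ℂ)) a b = single i j 1 (Fin.cons r a) (Fin.cons s b) := rfl
  simp only [h, single_apply, eq_iff_tail (i := i), eq_iff_tail (i := j), Fin.cons_zero,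
    Fin.tail_cons]
  by_cases h1 : i 0 = r <;> by_cases h2 : j 0 = s <;> simp [h1, h2, single_apply]

theorem Psi_succ_apply {N : ℕ} (X : Mat (N + 1)) (k l : Bits (N + 1)) :
    Psi (N + 1) X k l =
      (1 / 2 ^ N : ℂ) * psiBlock (Psi N) (k 0) (l 0) X (Fin.tail k) (Fin.tail l) := rfl

theorem Psi_single_same {N : ℕ} (i k l : Bits (N + 1)) :
    Psi (N + 1) (single i i 1) k l = if k = l ∧ k 0 ≠ i 0 then 1 / 2 ^ N else 0 := by
  rw [Psi_succ_apply, psiBlock]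
  simp only [eq_iff_tail (i := k) (j := l)]
  by_cases h0 : k 0 = l 0
  · rw [if_pos h0, block_single]
    by_cases h1 : i 0 = k 0
    · simp [h1]
    · have h2 : ¬ l 0 = i 0 := fun h => h1 (h.symm.trans h0.symm)
      have h3 : ¬ i 0 = l 0 := fun h => h2 h.symm
      simp [h0, h2, h3, one_apply]
  · have h1 : ¬ (i 0 = k 0 ∧ i 0 = l 0) := fun h => h0 (h.1.symm.trans h.2)
    have h2 : ¬ (i 0 = l 0 ∧ i 0 = k 0) := fun h => h1 h.symm
    rw [if_neg h0, block_single, block_single, if_neg h1, if_neg h2]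
    simp [h0]

theorem Psi_single_of_ne {N : ℕ} {i j : Bits (N + 1)} (hij : i 0 ≠ j 0) (k l : Bits (N + 1)) :
    Psi (N + 1) (single i j 1) k l = -(1 / 2 ^ N) * ((if k = i ∧ l = j then 1 else 0) +
      if k 0 = j 0 ∧ l 0 = i 0 then
        Psi N (single (Fin.tail i) (Fin.tail j) 1) (Fin.tail k) (Fin.tail l) else 0) := by
  have hne : i ≠ j := fun h => hij (congrFun h 0)
  rw [Psi_succ_apply, psiBlock]
  by_cases h0 : k 0 = l 0
  · have h1 : ¬ (i 0 = l 0 ∧ j 0 = l 0) := fun h => hij (h.1.trans h.2.symm)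
    have h2 : ¬ (k = i ∧ l = j) := fun h => hij (by rw [← h.1, ← h.2, h0])
    have h3 : ¬ (k 0 = j 0 ∧ l 0 = i 0) := fun h => hij (by rw [← h.1, ← h.2, h0])
    rw [if_pos h0, if_neg h2, if_neg h3, h0, block_single, if_neg h1,
      trace_single_eq_of_ne _ _ _ hne]
    simp
  · rw [if_neg h0, block_single, block_single]
    simp only [eq_iff_tail (i := k) (j := i), eq_iff_tail (i := l) (j := j)]
    by_cases h1 : i 0 = k 0
    · have h2 : k 0 ≠ j 0 := h1 ▸ hij
      have h3 : j 0 = l 0 := eq_of_ne_of_ne h2 h0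
      simp only [h1, h3, h0, and_self, true_and, if_true, Ne.symm h0, if_false, map_zero, add_zero,
        Matrix.neg_apply, single_apply, eq_comm (a := Fin.tail k), eq_comm (a := Fin.tail l)]
      ring
    · have h2 : j 0 = k 0 := eq_of_ne_of_ne hij h1
      have h3 : i 0 = l 0 := eq_of_ne_of_ne (Ne.symm h1) h0
      simp [h2, h3, h0, Ne.symm h0]

/-- The matrix elements `2 · 4^(M+1) ⟨i k| ρ_t |j l⟩` for `N = M + 2`, where `p = (i, k)` and
`q = (j, l)`. -/
noncomputable def rhoEntry (M : ℕ) (t : ℝ) (p q : Bits (M + 2) × Bits (M + 2)) : ℝ :=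
  if p.1 = q.1 then
    if p.2 = q.2 then (if p.2 0 = p.1 0 then 2 ^ (M + 1) else 1) else 0
  else if p.1 0 = q.1 0 then 0
  else if Fin.tail p.1 = Fin.tail q.1 then
    t * ((if p.2 = p.1 ∧ q.2 = q.1 then 1 else 0) +
      if p.2 0 = q.1 0 ∧ q.2 0 = p.1 0 ∧ Fin.tail p.2 = Fin.tail q.2 ∧
        Fin.tail p.2 0 ≠ Fin.tail p.1 0 then 1 / 2 ^ M else 0)
  else if p.2 = p.1 ∧ q.2 = q.1 then 1 else 0

theorem witnessBlock_same {N : ℕ} (i k l : Bits (N + 1)) :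
    witnessBlock (N + 1) i i k l =
      1 / (2 ^ (N + 1) * 2 ^ N) * if k = l ∧ k 0 ≠ i 0 then 1 else 0 := by
  rw [witnessBlock, Matrix.smul_apply, Psi_single_same, smul_eq_mul]
  split_ifs
  · field_simp
  · simp

theorem witnessBlock_of_tail_eq {M : ℕ} {i j : Bits (M + 2)} (h0 : i 0 ≠ j 0)
    (ht : Fin.tail i = Fin.tail j) (k l : Bits (M + 2)) :
    witnessBlock (M + 2) i j k l = -(1 / (2 ^ (M + 2) * 2 ^ (M + 1))) *
      ((if k = i ∧ l = j then 1 else 0) +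
        if k 0 = j 0 ∧ l 0 = i 0 ∧ Fin.tail k = Fin.tail l ∧ Fin.tail k 0 ≠ Fin.tail i 0
        then 1 / 2 ^ M else 0) := by
  rw [witnessBlock, Matrix.smul_apply, Psi_single_of_ne h0, ← ht, Psi_single_same, smul_eq_mul]
  by_cases h1 : k 0 = j 0 <;> by_cases h2 : l 0 = i 0 <;> simp [h1, h2] <;> ring_nf

theorem witnessBlock_diag_of_ne {N : ℕ} {i j : Bits (N + 1)} (h0 : i 0 ≠ j 0) :
    witnessBlock (N + 1) i j i j = -(1 / (2 ^ (N + 1) * 2 ^ N)) := by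
  rw [witnessBlock, Matrix.smul_apply, Psi_single_of_ne h0, smul_eq_mul]
  simp [h0]
  ring

theorem rhoBlock_apply (M : ℕ) (t : ℝ) (i j k l : Bits (M + 2)) :
    rhoBlock (M + 2) t i j k l =
      ((1 / (2 ^ (M + 2) * 2 ^ (M + 1)) * rhoEntry M t (i, k) (j, l) : ℝ) : ℂ) := by
  unfold rhoBlock rhoEntry
  dsimp only
  by_cases h : i = j
  · subst h
    rw [if_pos rfl, if_pos rfl, Matrix.sub_apply, Matrix.smul_apply, Matrix.smul_apply,
      witnessBlock_same, one_apply,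
      smul_eq_mul, smul_eq_mul]
    by_cases hk : k = l
    · by_cases h0 : k 0 = i 0
      · simp [hk, hk ▸ h0]
        field_simp
      · simp [hk, hk ▸ h0]
        field_simp
        ring
    · simp [hk]
  rw [if_neg h, if_neg h]
  by_cases h0 : i 0 = j 0
  · simp [h0]
  rw [if_neg h0, if_neg h0]
  by_cases ht : Fin.tail i = Fin.tail j
  · rw [if_pos ht, if_pos ht, Matrix.smul_apply, witnessBlock_of_tail_eq h0 ht, smul_eq_mul]
    push_cast
    simp only [apply_ite ((↑) : ℝ → ℂ)]
    push_cast
    ring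
  · rw [if_neg ht, if_neg ht, Matrix.smul_apply, single_apply, smul_eq_mul]
    simp only [eq_comm (a := i), eq_comm (a := j)]
    split_ifs <;> simp

theorem rho_apply (N : ℕ) (t : ℝ) (p q : Bits N × Bits N) :
    rho N t p q = rhoBlock N t p.1 q.1 p.2 q.2 := by
  simp only [rho, Matrix.sum_apply, kroneckerMap_apply, single_apply]
  rw [Finset.sum_eq_single p.1 (fun i _ hi => by simp [hi]) (by simp),
    Finset.sum_eq_single q.1 (fun i _ hi => by simp [hi]) (by simp)]
  simp

theorem rho_eq (M : ℕ) (t : ℝ) : rho (M + 2) t = of fun p q =>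
    ((1 / (2 ^ (M + 2) * 2 ^ (M + 1)) * rhoEntry M t p q : ℝ) : ℂ) := by
  ext p q
  rw [rho_apply, rhoBlock_apply]
  rfl

theorem rhoEntry_comm (M : ℕ) (t : ℝ) (p q : Bits (M + 2) × Bits (M + 2)) :
    rhoEntry M t p q = rhoEntry M t q p := by
  unfold rhoEntry
  by_cases h : p.1 = q.1
  · rw [if_pos h, if_pos h.symm]
    by_cases h2 : p.2 = q.2
    · rw [if_pos h2, if_pos h2.symm, h, h2]
    · rw [if_neg h2, if_neg (Ne.symm h2)]
  rw [if_neg h, if_neg (Ne.symm h)]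
  by_cases h0 : p.1 0 = q.1 0
  · rw [if_pos h0, if_pos h0.symm]
  rw [if_neg h0, if_neg (Ne.symm h0), if_congr (and_comm (a := q.2 = q.1)) rfl rfl]
  by_cases ht : Fin.tail p.1 = Fin.tail q.1
  · have hc : (p.2 0 = q.1 0 ∧ q.2 0 = p.1 0 ∧ Fin.tail p.2 = Fin.tail q.2 ∧
        Fin.tail p.2 0 ≠ Fin.tail p.1 0) ↔ (q.2 0 = p.1 0 ∧ p.2 0 = q.1 0 ∧
        Fin.tail q.2 = Fin.tail p.2 ∧ Fin.tail q.2 0 ≠ Fin.tail q.1 0) := by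
      rw [ht, eq_comm (a := Fin.tail q.2)]
      constructor
      · rintro ⟨a, b, c, d⟩
        exact ⟨b, a, c, c ▸ d⟩
      · rintro ⟨a, b, c, d⟩
        exact ⟨b, a, c, c.symm ▸ d⟩
    rw [if_pos ht, if_pos ht.symm, if_congr hc rfl rfl]
  · rw [if_neg ht, if_neg (Ne.symm ht)]

/-- A majorant of `|rhoEntry|` for `|t| ≤ 1`: the diagonal, the elements between `|i i⟩` and
`|j j⟩`, and those between `|i k⟩` and the pair of strings with both first bits toggled. -/
noncomputable def rhoBound (M : ℕ) (p q : Bits (M + 2) × Bits (M + 2)) : ℝ :=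
  (if p.1 = q.1 ∧ p.2 = q.2 then (if p.2 0 = p.1 0 then 2 ^ (M + 1) else 1) else 0) +
  (if q.1 0 ≠ p.1 0 ∧ p.2 = p.1 ∧ q.2 = q.1 then 1 else 0) +
  (if p.2 0 ≠ p.1 0 ∧ q.1 = flipFirst p.1 ∧ q.2 = flipFirst p.2 then 1 else 0)

theorem abs_rhoEntry_le {M : ℕ} {t : ℝ} (ht : |t| ≤ 1) (p q : Bits (M + 2) × Bits (M + 2)) :
    |rhoEntry M t p q| ≤ rhoBound M p q := by
  have n1 : (0 : ℝ) ≤ (if p.1 = q.1 ∧ p.2 = q.2 then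
      (if p.2 0 = p.1 0 then 2 ^ (M + 1) else 1) else 0) := by positivity
  have n2 : (0 : ℝ) ≤ (if q.1 0 ≠ p.1 0 ∧ p.2 = p.1 ∧ q.2 = q.1 then 1 else 0) := by positivity
  have n3 : (0 : ℝ) ≤ (if p.2 0 ≠ p.1 0 ∧ q.1 = flipFirst p.1 ∧ q.2 = flipFirst p.2
      then 1 else 0) := by positivity
  unfold rhoEntry rhoBound
  by_cases h : p.1 = q.1
  · rw [if_pos h]
    have : |if p.2 = q.2 then (if p.2 0 = p.1 0 then (2 : ℝ) ^ (M + 1) else 1) else 0| =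
        if p.1 = q.1 ∧ p.2 = q.2 then (if p.2 0 = p.1 0 then 2 ^ (M + 1) else 1) else 0 := by
      simp only [h, true_and]
      split_ifs <;> simp
    rw [this]
    linarith
  rw [if_neg h]
  by_cases h0 : p.1 0 = q.1 0
  · rw [if_pos h0, abs_zero]
    linarith
  rw [if_neg h0]
  have hs : (if p.2 = p.1 ∧ q.2 = q.1 then (1 : ℝ) else 0) =
      if q.1 0 ≠ p.1 0 ∧ p.2 = p.1 ∧ q.2 = q.1 then 1 else 0 := by
    simp only [ne_eq, Ne.symm h0, not_false_eq_true, true_and]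
  rw [hs]
  by_cases hta : Fin.tail p.1 = Fin.tail q.1
  · rw [if_pos hta, abs_mul]
    have hM : (1 : ℝ) / 2 ^ M ≤ 1 := by
      rw [div_le_one (by positivity)]
      exact one_le_pow₀ (by norm_num)
    have h3 : (if p.2 0 = q.1 0 ∧ q.2 0 = p.1 0 ∧ Fin.tail p.2 = Fin.tail q.2 ∧
        Fin.tail p.2 0 ≠ Fin.tail p.1 0 then (1 : ℝ) / 2 ^ M else 0) ≤
        if p.2 0 ≠ p.1 0 ∧ q.1 = flipFirst p.1 ∧ q.2 = flipFirst p.2 then 1 else 0 := by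
      split_ifs with ha hb hb
      · exact hM
      · refine absurd ⟨?_, ?_, ?_⟩ hb
        · rw [ha.1]
          exact Ne.symm h0
        · exact eq_flipFirst_iff.2 ⟨h0, hta⟩
        · refine eq_flipFirst_iff.2 ⟨?_, ha.2.2.1⟩
          rw [ha.1, ha.2.1]
          exact Ne.symm h0
      · norm_num
      · norm_num
    have h4 : (0 : ℝ) ≤ (if p.2 0 = q.1 0 ∧ q.2 0 = p.1 0 ∧ Fin.tail p.2 = Fin.tail q.2 ∧
        Fin.tail p.2 0 ≠ Fin.tail p.1 0 then (1 : ℝ) / 2 ^ M else 0) := by positivity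
    rw [abs_of_nonneg (add_nonneg n2 h4)]
    refine (mul_le_of_le_one_left (add_nonneg n2 h4) ht).trans ?_
    linarith
  · rw [if_neg hta, abs_of_nonneg n2]
    linarith

theorem rhoEntry_self (M : ℕ) (t : ℝ) (p : Bits (M + 2) × Bits (M + 2)) :
    rhoEntry M t p p = if p.2 0 = p.1 0 then 2 ^ (M + 1) else 1 := by
  simp [rhoEntry]

theorem sum_rhoBound_le (M : ℕ) (p : Bits (M + 2) × Bits (M + 2)) :
    ∑ q, rhoBound M p q ≤ 2 * if p.2 0 = p.1 0 then 2 ^ (M + 1) else 1 := by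
  obtain ⟨i, k⟩ := p
  simp only [rhoBound, Fintype.sum_prod_type, Finset.sum_add_distrib]
  have s1 : ∑ j, ∑ l, (if i = j ∧ k = l then (if k 0 = i 0 then (2 : ℝ) ^ (M + 1) else 1) else 0)
      = if k 0 = i 0 then 2 ^ (M + 1) else 1 := by
    simp [ite_and]
  have s2 : ∑ j : Bits (M + 2), ∑ l, (if j 0 ≠ i 0 ∧ k = i ∧ l = j then (1 : ℝ) else 0)
      = if k = i then 2 ^ (M + 1) else 0 := by
    by_cases h : k = i
    · have : ∀ j : Bits (M + 2), ∑ l, (if j 0 ≠ i 0 ∧ k = i ∧ l = j then (1 : ℝ) else 0) =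
          if j 0 ≠ i 0 then 1 else 0 := fun j => by simp [h, ite_and]
      rw [Finset.sum_congr rfl fun j _ => this j, sum_first_ne, if_pos h, mul_one]
    · simp [h]
  have s3 : ∑ j, ∑ l, (if k 0 ≠ i 0 ∧ j = flipFirst i ∧ l = flipFirst k then (1 : ℝ) else 0)
      = if k 0 ≠ i 0 then 1 else 0 := by
    simp [ite_and]
  rw [s1, s2, s3]
  by_cases h0 : k 0 = i 0
  · have : (if k = i then (2 : ℝ) ^ (M + 1) else 0) ≤ 2 ^ (M + 1) := by
      split_ifs
      · exact le_rfl
      · positivity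
    simp [h0]
    linarith
  · have h1 : k ≠ i := fun h => h0 (congrFun h 0)
    simp [h0, h1]
    norm_num

theorem sum_rhoBound_partialTranspose_le (M : ℕ) (p : Bits (M + 2) × Bits (M + 2)) :
    ∑ q : Bits (M + 2) × Bits (M + 2), rhoBound M (p.1, q.2) (q.1, p.2) ≤
      2 * if p.2 0 = p.1 0 then 2 ^ (M + 1) else 1 := by
  obtain ⟨i, k⟩ := p
  simp only [rhoBound, Fintype.sum_prod_type, Finset.sum_add_distrib]
  have s1 : ∑ j, ∑ l : Bits (M + 2),
      (if i = j ∧ l = k then (if l 0 = i 0 then (2 : ℝ) ^ (M + 1) else 1) else 0)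
      = if k 0 = i 0 then 2 ^ (M + 1) else 1 := by
    simp [ite_and]
  have s2 : ∑ j : Bits (M + 2), ∑ l, (if j 0 ≠ i 0 ∧ l = i ∧ k = j then (1 : ℝ) else 0)
      = if k 0 ≠ i 0 then 1 else 0 := by
    rw [Finset.sum_eq_single k (fun j _ hj => by simp [Ne.symm hj]) (by simp)]
    simp [ite_and]
  have s3 : ∑ j, ∑ l : Bits (M + 2),
      (if l 0 ≠ i 0 ∧ j = flipFirst i ∧ k = flipFirst l then (1 : ℝ) else 0)
      ≤ if k 0 = i 0 then 1 else 0 := by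
    have hk : ∀ l : Bits (M + 2), k = flipFirst l ↔ l = flipFirst k := fun l => by
      rw [eq_flipFirst_iff, eq_flipFirst_iff, ne_comm, eq_comm (a := Fin.tail l)]
    simp only [hk]
    rw [Finset.sum_eq_single (flipFirst i) (fun j _ hj => by simp [hj]) (by simp),
      Finset.sum_eq_single (flipFirst k) (fun l _ hl => by simp [hl]) (by simp)]
    have := ne_iff_eq_add_one.1 (flipFirst_zero k).symm
    by_cases h0 : k 0 = i 0
    · rw [if_pos h0]
      split_ifs <;> norm_num
    · rw [if_neg h0, if_neg]
      rintro ⟨h1, -⟩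
      exact h1 (by rw [this, ne_iff_eq_add_one.1 h0])
  rw [s1, s2]
  have hD : (1 : ℝ) ≤ 2 ^ (M + 1) := one_le_pow₀ (by norm_num)
  by_cases h0 : k 0 = i 0
  · simp only [h0, if_true, ne_eq, not_true_eq_false, if_false] at s3 ⊢
    linarith
  · simp only [h0, if_false, ne_eq, not_false_eq_true, if_true] at s3 ⊢
    linarith

theorem rho_posSemidef {M : ℕ} {t : ℝ} (ht : |t| ≤ 1) : (rho (M + 2) t).PosSemidef := by
  rw [rho_eq]
  refine posSemidef_of_sum_abs_le (R := of fun p q => 1 / (2 ^ (M + 2) * 2 ^ (M + 1)) *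
    rhoEntry M t p q) (fun p q => by simp only [of_apply, rhoEntry_comm M t p q]) fun p => ?_
  have h := (Finset.sum_le_sum fun q _ => abs_rhoEntry_le ht p q).trans (sum_rhoBound_le M p)
  rw [← rhoEntry_self M t] at h
  simp only [of_apply, abs_mul, ← Finset.mul_sum]
  rw [abs_of_pos (by positivity), mul_left_comm]
  gcongr

theorem rho_partialTranspose_posSemidef {M : ℕ} {t : ℝ} (ht : |t| ≤ 1) :
    (partialTranspose (rho (M + 2) t)).PosSemidef := by
  set c : ℝ := 1 / (2 ^ (M + 2) * 2 ^ (M + 1)) with hc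
  have hc0 : 0 < c := by positivity
  set R : Matrix (Bits (M + 2) × Bits (M + 2)) (Bits (M + 2) × Bits (M + 2)) ℝ :=
    of fun p q => c * rhoEntry M t (p.1, q.2) (q.1, p.2) with hR
  have hRapp : ∀ p q, R p q = c * rhoEntry M t (p.1, q.2) (q.1, p.2) := fun _ _ => rfl
  have heq : partialTranspose (rho (M + 2) t) = of fun p q => (R p q : ℂ) := by
    ext p q
    rw [partialTranspose, of_apply, of_apply, rho_eq, of_apply, hRapp]
  rw [heq]
  refine posSemidef_of_sum_abs_le (fun p q => ?_) fun p => ?_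
  · rw [hRapp, hRapp, rhoEntry_comm M t (p.1, q.2)]
  · have h := (Finset.sum_le_sum fun q _ =>
      abs_rhoEntry_le ht (p.1, q.2) (q.1, p.2)).trans (sum_rhoBound_partialTranspose_le M p)
    rw [← rhoEntry_self M t] at h
    simp only [hRapp, abs_mul, ← Finset.mul_sum]
    rw [abs_of_pos hc0, mul_left_comm]
    exact mul_le_mul_of_nonneg_left h hc0.le

theorem rho_ne_zero (M : ℕ) (t : ℝ) : rho (M + 2) t ≠ 0 := by
  intro h
  have h1 := congrFun (congrFun h (0, 0)) (0, 0)
  rw [rho_eq, of_apply, rhoEntry_self] at h1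
  simp at h1

/-- The bound comes from the `2 × 2` minor of `ρ_t^Γ` on `|0…0⟩ ⊗ |10…0⟩` and `|10…0⟩ ⊗ |0…0⟩`. -/
theorem abs_le_one_of_partialTranspose_posSemidef {M : ℕ} {t : ℝ}
    (h : (partialTranspose (rho (M + 2) t)).PosSemidef) : |t| ≤ 1 := by
  have h1 := h.submatrix ![((0 : Bits (M + 2)), flipFirst 0), (flipFirst 0, 0)]
  set i : Bits (M + 2) := 0
  set j : Bits (M + 2) := flipFirst 0
  have h0 : j 0 ≠ i 0 := flipFirst_zero _
  have hij : i ≠ j := fun h => h0 (congrFun h.symm 0)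
  have htail : Fin.tail i = Fin.tail j := (tail_flipFirst _).symm
  have e0 : rhoEntry M t (i, j) (i, j) = 1 := by rw [rhoEntry_self, if_neg h0]
  have e1 : rhoEntry M t (j, i) (j, i) = 1 := by rw [rhoEntry_self, if_neg h0.symm]
  have e2 : rhoEntry M t (i, i) (j, j) = t := by
    simp [rhoEntry, hij, h0.symm, htail]
  have e3 := rhoEntry_comm M t (i, i) (j, j)
  have hdet := h1.det_nonneg
  rw [det_fin_two, rho_eq] at hdet
  simp only [submatrix_apply, partialTranspose, of_apply, cons_val_zero, cons_val_one, e0, e1, e2,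
    ← e3, ← Complex.ofReal_mul, ← Complex.ofReal_sub, Complex.zero_le_real] at hdet
  have hc : (0 : ℝ) < 1 / (2 ^ (M + 2) * 2 ^ (M + 1)) := by positivity
  set c : ℝ := 1 / (2 ^ (M + 2) * 2 ^ (M + 1))
  have : 0 ≤ c ^ 2 * (1 - t ^ 2) := by linarith
  have := nonneg_of_mul_nonneg_right this (by positivity)
  exact abs_le_one_iff_mul_self_le_one.2 (by nlinarith)

theorem rho_isPPTState_iff (M : ℕ) (t : ℝ) : IsPPTState (rho (M + 2) t) ↔ |t| ≤ 1 :=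
  ⟨fun h => abs_le_one_of_partialTranspose_posSemidef h.2,
    fun h => ⟨⟨rho_posSemidef h, rho_ne_zero M t⟩, rho_partialTranspose_posSemidef h⟩⟩

/-! ### The pairing of `W_N` with `ρ_t` -/

/-- The contribution of the block pair `(i, j)` to `Tr (W_N ρ_t)`, where `N = M + 2`. In
units of the squared prefactor and for fixed `i`, the `2^(M+1)`
blocks with `j 0 ≠ i 0` contribute `-1` each (corrected for `j = flipFirst i`, where `ρ_{ji}` is a
multiple of `W_{ji}`), which cancels the diagonal contribution `2^(M+1)`. -/
theorem trace_witnessBlock_mul_rhoBlock (M : ℕ) (t : ℝ) (i j : Bits (M + 2)) :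
    (witnessBlock (M + 2) i j * rhoBlock (M + 2) t j i).trace =
      (((1 / (2 ^ (M + 2) * 2 ^ (M + 1))) ^ 2 *
        ((if j = i then 2 ^ (M + 1) else 0) +
          (if j = flipFirst i then 1 - t * (1 + 1 / 2 ^ M) else 0) -
            if j 0 ≠ i 0 then 1 else 0) : ℝ) : ℂ) := by
  simp only [trace, diag_apply, mul_apply, rhoBlock_apply]
  by_cases h : j = i
  · subst h
    have h1 : j ≠ flipFirst j := fun h => flipFirst_zero j (congrFun h 0).symm
    have hs := sum_first_ne (N := M + 1) (j 0) 1
    have : ∀ k l : Bits (M + 2), witnessBlock (M + 2) j j k l *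
        ((1 / (2 ^ (M + 2) * 2 ^ (M + 1)) * rhoEntry M t (j, l) (j, k) : ℝ) : ℂ) =
        if l = k then (((1 / (2 ^ (M + 2) * 2 ^ (M + 1))) ^ 2 *
          (if k 0 ≠ j 0 then 1 else 0) : ℝ) : ℂ) else 0 := by
      intro k l
      rw [witnessBlock_same]
      by_cases hkl : l = k
      · subst hkl
        by_cases h0 : l 0 = j 0
        · simp [h0]
        · simp [h0, rhoEntry]
          ring
      · simp [hkl, Ne.symm hkl]
    simp only [this, Finset.sum_ite_eq', Finset.mem_univ, if_true]
    rw [← Complex.ofReal_sum, ← Finset.mul_sum, hs]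
    simp [h1]
  by_cases h0 : j 0 = i 0
  · have h1 : j ≠ flipFirst i := fun h => flipFirst_zero i (h ▸ h0)
    simp [rhoEntry, h, h0, h1]
  by_cases ht : Fin.tail j = Fin.tail i
  · have hf : j = flipFirst i := eq_flipFirst_iff.2 ⟨Ne.symm h0, ht.symm⟩
    have : ∀ k l : Bits (M + 2), witnessBlock (M + 2) i j k l *
        ((1 / (2 ^ (M + 2) * 2 ^ (M + 1)) * rhoEntry M t (j, l) (i, k) : ℝ) : ℂ) =
        (((1 / (2 ^ (M + 2) * 2 ^ (M + 1))) ^ 2 * -t *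
          ((if k = i then if l = j then 1 else 0 else 0) +
            if l = flipFirst k then
              if k 0 ≠ i 0 then if Fin.tail k 0 ≠ Fin.tail i 0 then (1 / 2 ^ M) ^ 2 else 0 else 0
            else 0) : ℝ) : ℂ) := by
      intro k l
      have hc : (l 0 = i 0 ∧ k 0 = j 0 ∧ Fin.tail l = Fin.tail k ∧ Fin.tail l 0 ≠ Fin.tail j 0) ↔
          (l = flipFirst k ∧ k 0 ≠ i 0 ∧ Fin.tail k 0 ≠ Fin.tail i 0) := by
        rw [eq_flipFirst_iff, ht]
        constructor
        · rintro ⟨a, b, c, d⟩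
          exact ⟨⟨by rw [a, b]; exact h0, c.symm⟩, by rw [b]; exact h0, c ▸ d⟩
        · rintro ⟨⟨a, b⟩, c, d⟩
          exact ⟨eq_of_ne_of_ne a c, eq_of_ne_of_ne (Ne.symm c) (Ne.symm h0), b.symm, b ▸ d⟩
      have hc' : (k 0 = j 0 ∧ l 0 = i 0 ∧ Fin.tail k = Fin.tail l ∧
          Fin.tail k 0 ≠ Fin.tail i 0) ↔
          (l = flipFirst k ∧ k 0 ≠ i 0 ∧ Fin.tail k 0 ≠ Fin.tail i 0) := by
        rw [← hc, ht]
        constructor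
        · rintro ⟨a, b, c, d⟩
          exact ⟨b, a, c.symm, c ▸ d⟩
        · rintro ⟨a, b, c, d⟩
          exact ⟨b, a, c.symm, c ▸ d⟩
      have he : rhoEntry M t (j, l) (i, k) = t * ((if k = i ∧ l = j then 1 else 0) +
          if l = flipFirst k ∧ k 0 ≠ i 0 ∧ Fin.tail k 0 ≠ Fin.tail i 0
          then 1 / 2 ^ M else 0) := by
        rw [rhoEntry, if_neg h, if_neg h0, if_pos ht, if_congr hc rfl rfl,
          if_congr and_comm rfl rfl]
      rw [witnessBlock_of_tail_eq (Ne.symm h0) ht.symm, he, if_congr hc' rfl rfl]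
      -- the two kinds of matrix elements have disjoint supports
      by_cases h1 : k = i
      · by_cases h2 : l = j <;> simp [h1, h2] <;> ring
      · by_cases h2 : l = flipFirst k <;> by_cases h3 : k 0 = i 0 <;>
          by_cases h4 : Fin.tail k 0 = Fin.tail i 0 <;> simp [h1, h2, h3, h4] <;> ring
    have hs : ∑ k : Bits (M + 2), (if k 0 ≠ i 0 then
        if Fin.tail k 0 ≠ Fin.tail i 0 then ((1 : ℝ) / 2 ^ M) ^ 2 else 0 else 0) = 1 / 2 ^ M := by
      rw [sum_bits_succ]
      simp only [Fin.cons_zero, Fin.tail_cons]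
      rw [Finset.sum_eq_single (i 0 + 1)]
      · have hn := ne_iff_eq_add_one.2 (rfl : i 0 + 1 = i 0 + 1)
        simp only [ne_eq, Ne.symm hn, not_false_eq_true, if_true]
        rw [sum_first_ne (N := M) (Fin.tail i 0)]
        field_simp
      · intro r _ hr
        refine Finset.sum_eq_zero fun a _ => if_neg fun h => hr ?_
        exact ne_iff_eq_add_one.1 (Ne.symm h)
      · simp
    simp only [this, ← Complex.ofReal_sum, ← Finset.mul_sum, Finset.sum_add_distrib]
    congr 1
    simp only [Finset.sum_ite_eq', Finset.mem_univ, if_true]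
    rw [hs, if_neg h, if_pos hf, if_pos h0, Finset.sum_eq_single i]
    · simp
      ring
    · intro k _ hk
      simp [hk]
    · simp
  · have hf : j ≠ flipFirst i := fun h => ht (eq_flipFirst_iff.1 h).2.symm
    rw [Finset.sum_eq_single i, Finset.sum_eq_single j, witnessBlock_diag_of_ne (Ne.symm h0)]
    · simp [rhoEntry, h, h0, ht, hf]
      ring
    · intro l _ hl
      simp [rhoEntry, h, h0, ht, hl]
    · simp
    · intro k _ hk
      simp [rhoEntry, h, h0, ht, hk]
    · simp

theorem trace_witness_mul_rho (M : ℕ) (t : ℝ) :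
    (witness (M + 2) * rho (M + 2) t).trace =
      (((-4 * t * (2 ^ (M + 2) + 4) + 2 ^ (M + 2 + 2)) / 2 ^ (4 * (M + 2)) : ℝ) : ℂ) := by
  have h : (witness (M + 2) * rho (M + 2) t).trace =
      ∑ i, ∑ j, (witnessBlock (M + 2) i j * rhoBlock (M + 2) t j i).trace := by
    simp only [trace, diag_apply, mul_apply, witness_apply, rho_apply, Fintype.sum_prod_type]
    exact Finset.sum_congr rfl fun i _ => Finset.sum_comm
  have hs : ∀ i : Bits (M + 2), ∑ j : Bits (M + 2), ((if j = i then (2 : ℝ) ^ (M + 1) else 0) +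
      (if j = flipFirst i then 1 - t * (1 + 1 / 2 ^ M) else 0) - if j 0 ≠ i 0 then 1 else 0) =
      1 - t * (1 + 1 / 2 ^ M) := by
    intro i
    rw [Finset.sum_sub_distrib, Finset.sum_add_distrib, sum_first_ne]
    simp
  simp only [h, trace_witnessBlock_mul_rhoBlock, ← Complex.ofReal_sum, ← Finset.mul_sum, hs]
  congr 1
  simp only [Finset.sum_const, Finset.card_univ, Fintype.card_fun, Fintype.card_fin, nsmul_eq_mul]
  push_cast
  rw [pow_mul']
  field_simp
  ring

theorem trace_witness_mul_rho_neg {M : ℕ} {t : ℝ} (ht : 2 ^ (M + 2) / (2 ^ (M + 2) + 4) < t) :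
    (witness (M + 2) * rho (M + 2) t).trace < 0 := by
  rw [trace_witness_mul_rho, ← Complex.ofReal_zero, Complex.real_lt_real]
  rw [div_lt_iff₀ (by positivity)] at ht
  refine div_neg_of_neg_of_pos ?_ (by positivity)
  rw [pow_add 2 (M + 2) 2]
  linarith

end QubitWitness

open QubitWitness
theorem theorem2 (N : ℕ) (hN : 1 < N) :
    IsIndecomposableMap (Psi N) ∧
    IsIndecomposableWitness (witness N) ∧
    (∀ t : ℝ, IsPPTState (rho N t) ↔ |t| ≤ 1) ∧
    (∀ t : ℝ, (witness N * rho N t).trace =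
      (((-4 * t * (2 ^ N + 4) + 2 ^ (N + 2)) / 2 ^ (4 * N) : ℝ) : ℂ)) ∧
    (∀ t : ℝ, 2 ^ N / (2 ^ N + 4) < t → t ≤ 1 →
      (witness N * rho N t).trace < 0 ∧
        IsPPTState (rho N t) ∧ IsEntangledState (rho N t)) := by
  obtain ⟨M, rfl⟩ : ∃ M, N = M + 2 := ⟨N - 2, by omega⟩
  have hprod := productVec_idTensor_maxEntangled_nonneg (Psi_isPositiveMap (M + 2))
  have hppt : ∀ t : ℝ, 2 ^ (M + 2) / (2 ^ (M + 2) + 4) < t → t ≤ 1 →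
      IsPPTState (rho (M + 2) t) := fun t h0 h1 => by
    have : (0 : ℝ) < 2 ^ (M + 2) / (2 ^ (M + 2) + 4) := by positivity
    exact (rho_isPPTState_iff M t).2 (abs_le.2 ⟨by linarith, h1⟩)
  -- `ρ_1` detects the indecomposability of `W_N`, and hence that of `Ψ_N`
  have hone : (2 : ℝ) ^ (M + 2) / (2 ^ (M + 2) + 4) < 1 := by
    rw [div_lt_one (by positivity)]
    linarith
  have hneg := trace_witness_mul_rho_neg hone
  have hρ := hppt 1 hone le_rfl
  have hdec : ¬ IsDecomposableOperator (witness (M + 2)) :=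
    not_isDecomposableOperator_of_trace_neg hρ hneg
  refine ⟨⟨Psi_isPositiveMap _, fun h => hdec h.idTensor_maxEntangled⟩,
    ⟨⟨witness_isHermitian _, hprod, exists_neg_eigenvalue_of_trace_neg (witness_isHermitian _)
      hρ.1.1 hneg⟩, hdec⟩, rho_isPPTState_iff M, trace_witness_mul_rho M, fun t h0 h1 => ?_⟩
  have ht := trace_witness_mul_rho_neg h0
  exact ⟨ht, hppt t h0 h1, (hppt t h0 h1).1, not_isSeparable_of_trace_neg hprod ht⟩
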